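/- Let $M$ be a finite von Neumann algebra (on a complex Hilbert space) with a faithful normal tracial state $\tau$, let $\phi$ be a normal state of $M$, and let $A,B$ be (unital) von Neumann subalgebras of $M$. Let $E_A, E_B$ be the unique $\tau$-preserving conditional expectations of $M$ onto $A$ and $B$, and put $\eta(t)=-t\log t$ for $t>0$, $\eta(0)=0$. For positive linear functionals $\psi,\varphi$ on a unital $C^*$-algebra $C$ let $S(\psi,\varphi)\in(-\infty,\infty]$ be the relative entropy $$S(\psi,\varphi)=\sup_{n\ge1}\ \sup_x\Big\{\psi(1)\log n-\int_{1/n}^\infty\Big(\psi(y(t)^*y(t))+\tfrac1t\,\varphi(x(t)x(t)^*)\Big)\frac{dt}{t}\Big\},$$ where $x:(\frac1n,\infty)\to C$ ranges over the step functions with finite range and $y(t)=1-x(t)$. Let $\Phi$ be the set of all finite families $(\phi_i)_i$ of positive linear functionals on $M$ with $\phi=\sum_i\phi_i$, and let $\Phi(A)$ be the set of all families $(\phi_i\circ E_A)_i$ with $(\phi_i)_i\in\Phi$. Define, for von Neumann subalgebras $A,B\subset M$, $$H_\phi(A|B)=\sup_{(\phi_i)\in\Phi}\sum_i\big(S(\phi_i|_A,\phi|_A)-S(\phi_i|_B,\phi|_B)\big),$$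 $$h_\phi(A|B)=\sup_{(\phi_i)\in\Phi}\sum_i\big(S(\phi_i|_A,\phi|_A)-S((\phi_i\circ E_A)|_B,(\phi\circ E_A)|_B)\big),$$ $$H_\phi(A)=\sup_{(\phi_i)\in\Phi}\sum_i\big(\eta(\phi_i(1))+S(\phi_i|_A,\phi|_A)\big),\qquad h_\phi(A)=\sup_{(\phi_i)\in\Phi(A)}\sum_i\big(\eta(\phi_i(1))+S(\phi_i|_A,\phi|_A)\big).$$ Then the following hold. (1) $h_\phi(A|B)\le h_\phi(A|\mathbb C1)=h_\phi(A)$. (2) If $E_AE_B=E_BE_A$, then $h_\phi(A|B)=h_\phi(A|A\cap B)$. Hence, if moreover $A\cap B=\mathbb C1$, then $h_\phi(A|B)=h_\phi(A)$. (3) If $E_AE_B=E_BE_A$ and $\phi=\phi\circ E_A$, then $H_\phi(A|B)=H_\phi(A|A\cap B)$. In particular, if moreover $A\cap B=\mathbb C1$, then $H_\phi(A|B)=H_\phi(A)$. (4) If $B\subset A$, then $H_\phi(A|B)=h_\phi(A|B)$. In particular (with no condition relating $A$ and $B$), $H_\phi(A)=h_\phi(A)$. -/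

import Mathlib

open MeasureTheory
open scoped ComplexOrder ENNReal

noncomputable section

namespace VNEntropy

/-! ### Positive functionals and relative entropy on a unital C⋆-algebra -/

section RelativeEntropy

variable {C : Type*} [Ring C] [StarRing C] [Algebra ℂ C]

/-- A linear functional `ψ` is positive if `ψ (a⋆ a) ≥ 0` for all `a`. -/
def IsPositive (ψ : C →ₗ[ℂ] ℂ) : Prop := ∀ a : C, 0 ≤ ψ (star a * a)

/-- A step function with values in `C` that takes finitely many values, each of them on a
measurable set. -/
def IsStep (x : ℝ → C) : Prop :=
  (Set.range x).Finite ∧ ∀ c : C, MeasurableSet (x ⁻¹' {c})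

/-- For a step function `x` and `y = 1 - x`, the (possibly infinite) integral
`∫_{1/n}^∞ (ψ (y(t)⋆ y(t)) + t⁻¹ φ (x(t) x(t)⋆)) dt / t`. -/
def kosakiIntegral (ψ φ : C →ₗ[ℂ] ℂ) (n : ℕ) (x : ℝ → C) : ℝ≥0∞ :=
  ∫⁻ t in Set.Ioi (1 / (n : ℝ)), ENNReal.ofReal
    (((ψ (star (1 - x t) * (1 - x t))).re + 1 / t * (φ (x t * star (x t))).re) / t)

/-- The relative entropy `S(ψ, φ)` of positive linear functionals `ψ`, `φ` on the unital
C⋆-algebra `C`, in the convention in which `S(ψ, φ) = Tr (ρ_ψ (log ρ_ψ - log ρ_φ))` for matrices: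
`sup_{n ≥ 1} sup_x (ψ(1) log n - ∫_{1/n}^∞ (ψ (y⋆ y) + t⁻¹ φ (x x⋆)) dt / t)`. -/
def relEntropy (ψ φ : C →ₗ[ℂ] ℂ) : EReal :=
  ⨆ (n : ℕ) (_ : 1 ≤ n) (x : ℝ → C) (_ : IsStep x),
    (((ψ 1).re * Real.log n : ℝ) : EReal) - (kosakiIntegral ψ φ n x : EReal)

end RelativeEntropy

/-! ### Von Neumann algebras on a Hilbert space -/

variable {H : Type*} [NormedAddCommGroup H] [InnerProductSpace ℂ H] [CompleteSpace H]

/-- The intersection `A ∩ B` of two von Neumann algebras on `H`. -/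
def inter (A B : VonNeumannAlgebra H) : VonNeumannAlgebra H where
  toStarSubalgebra := A.toStarSubalgebra ⊓ B.toStarSubalgebra
  centralizer_centralizer' := by
    apply Set.Subset.antisymm
    · intro x hx
      refine ⟨?_, ?_⟩
      · have h := A.centralizer_centralizer'
        rw [Set.ext_iff] at h
        exact (h x).1 (Set.centralizer_subset (Set.centralizer_subset fun _ h => h.1) hx)
      · have h := B.centralizer_centralizer'
        rw [Set.ext_iff] at h
        exact (h x).1 (Set.centralizer_subset (Set.centralizer_subset fun _ h => h.2) hx)
    · exact Set.subset_centralizer_centralizer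

variable (H) in
/-- The von Neumann algebra `ℂ1` of scalar operators on `H`. -/
def scalars : VonNeumannAlgebra H where
  toStarSubalgebra := ⊥
  centralizer_centralizer' := by
    apply Set.Subset.antisymm
    · intro x hx
      have h1 : x ∈ Subalgebra.center ℂ (H →L[ℂ] H) := by
        rw [Subalgebra.mem_center_iff]
        intro b
        refine hx b ?_
        rintro a ha
        obtain ⟨c, rfl⟩ := StarSubalgebra.mem_bot.1 ha
        exact Algebra.commutes c b
      rw [Algebra.IsCentral.center_eq_bot] at h1
      obtain ⟨c, rfl⟩ := Algebra.mem_bot.1 h1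
      exact StarSubalgebra.mem_bot.2 ⟨c, rfl⟩
    · exact Set.subset_centralizer_centralizer

theorem inter_le_left (A B : VonNeumannAlgebra H) : inter A B ≤ A := fun _ h => h.1

theorem scalars_le (A : VonNeumannAlgebra H) : scalars H ≤ A := by
  intro x hx
  obtain ⟨c, rfl⟩ := StarSubalgebra.mem_bot.1 hx
  exact A.toStarSubalgebra.algebraMap_mem c

/-- Linear functionals on the von Neumann algebra `M`. -/
abbrev Functional (M : VonNeumannAlgebra H) : Type _ := M.toStarSubalgebra →ₗ[ℂ] ℂ

/-- Linear maps of the von Neumann algebra `M` to itself. -/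
abbrev SelfMap (M : VonNeumannAlgebra H) : Type _ :=
  M.toStarSubalgebra →ₗ[ℂ] M.toStarSubalgebra

variable {M A B : VonNeumannAlgebra H}

/-- The restriction `φ|_A` of a functional on `M` to a von Neumann subalgebra `A`. -/
def restrict (hA : A ≤ M) (φ : Functional M) : Functional A :=
  φ ∘ₗ (StarSubalgebra.inclusion (S₁ := A.toStarSubalgebra) (S₂ := M.toStarSubalgebra)
    hA).toAlgHom.toLinearMap

/-- Normality: `φ` is ultraweakly (σ-weakly) continuous, that is, of the form
`φ x = ∑ₙ ⟪ηₙ, x ξₙ⟫` with `∑ₙ ‖ξₙ‖² < ∞` and `∑ₙ ‖ηₙ‖² < ∞`. -/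
def IsNormal (φ : Functional M) : Prop :=
  ∃ ξ η : ℕ → H, Summable (fun n => ‖ξ n‖ ^ 2) ∧ Summable (fun n => ‖η n‖ ^ 2) ∧
    ∀ x : M.toStarSubalgebra,
      HasSum (fun n => inner ℂ (η n) ((x : H →L[ℂ] H) (ξ n))) (φ x)

/-- Normal states. -/
structure IsNormalState (φ : Functional M) : Prop where
  positive : IsPositive φ
  map_one : φ 1 = 1
  normal : IsNormal φ

/-- Faithful normal tracial states. -/
structure IsFaithfulNormalTrace (τ : Functional M) : Prop extends IsNormalState τ where
  tracial : ∀ x y, τ (x * y) = τ (y * x)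
  faithful : ∀ x, τ (star x * x) = 0 → x = 0

/-- `E : M → M` is a `τ`-preserving conditional expectation of `M` onto `A`. -/
structure IsCondExp (τ : Functional M) (A : VonNeumannAlgebra H) (E : SelfMap M) : Prop where
  mem : ∀ x, (E x : H →L[ℂ] H) ∈ A
  map_of_mem : ∀ a : M.toStarSubalgebra, (a : H →L[ℂ] H) ∈ A → E a = a
  positive : ∀ x, ∃ y, E (star x * x) = star y * y
  bimodule : ∀ a b x : M.toStarSubalgebra, (a : H →L[ℂ] H) ∈ A → (b : H →L[ℂ] H) ∈ A →
    E (a * x * b) = a * E x * b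
  trace_preserving : ∀ x, τ (E x) = τ x

/-- There is at most one `τ`-preserving conditional expectation onto `A`. -/
theorem IsCondExp.unique {τ : Functional M} (hτ : IsFaithfulNormalTrace τ) {E F : SelfMap M}
    (hE : IsCondExp τ A E) (hF : IsCondExp τ A F) : E = F := by
  have key : ∀ {G : SelfMap M}, IsCondExp τ A G → ∀ b x : M.toStarSubalgebra,
      (b : H →L[ℂ] H) ∈ A → τ (b * G x) = τ (b * x) := by
    intro G hG b x hb
    have h := hG.bimodule b 1 x hb A.toStarSubalgebra.one_mem
    rw [mul_one, mul_one] at h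
    rw [← h, hG.trace_preserving]
  ext1 x
  rw [← sub_eq_zero]
  apply hτ.faithful
  have hb : ((star (E x - F x) : M.toStarSubalgebra) : H →L[ℂ] H) ∈ A :=
    A.toStarSubalgebra.star_mem' (A.toStarSubalgebra.sub_mem (hE.mem x) (hF.mem x))
  rw [mul_sub, map_sub, key hE _ _ hb, key hF _ _ hb, sub_self]

open scoped Classical in
/-- The conditional expectation `E_A` of `M` onto `A` that preserves the faithful normal tracial
state `τ`. -/
def condExp (τ : Functional M) (A : VonNeumannAlgebra H) : SelfMap M :=
  if h : ∃ E : SelfMap M, IsCondExp τ A E then h.choose else 0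

/-- The families `(φ₁, …, φ_k)` of positive linear functionals on `M` with `φ = ∑ᵢ φᵢ`. -/
def decomp (φ : Functional M) (k : ℕ) : Set (Fin k → Functional M) :=
  {f | (∀ i, IsPositive (f i)) ∧ φ = ∑ i, f i}

/-- The families `(φ₁ ∘ E_A, …, φ_k ∘ E_A)`, where `(φ₁, …, φ_k)` is a finite family of positive
linear functionals on `M` with sum `φ`. -/
def decompInv (τ φ : Functional M) (A : VonNeumannAlgebra H) (k : ℕ) :
    Set (Fin k → Functional M) :=
  {g | ∃ f ∈ decomp φ k, ∀ i, g i = f i ∘ₗ condExp τ A}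

/-- `H_φ(A | B) = sup ∑ᵢ (S(φᵢ|_A, φ|_A) - S(φᵢ|_B, φ|_B))`. -/
def relH (φ : Functional M) (hA : A ≤ M) (hB : B ≤ M) : EReal :=
  ⨆ (k : ℕ) (f : Fin k → Functional M) (_ : f ∈ decomp φ k),
    ∑ i, (relEntropy (restrict hA (f i)) (restrict hA φ)
      - relEntropy (restrict hB (f i)) (restrict hB φ))

/-- `h_φ(A | B) = sup ∑ᵢ (S(φᵢ|_A, φ|_A) - S((φᵢ ∘ E_A)|_B, (φ ∘ E_A)|_B))`. -/
def relh (τ φ : Functional M) (hA : A ≤ M) (hB : B ≤ M) : EReal :=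
  ⨆ (k : ℕ) (f : Fin k → Functional M) (_ : f ∈ decomp φ k),
    ∑ i, (relEntropy (restrict hA (f i)) (restrict hA φ)
      - relEntropy (restrict hB (f i ∘ₗ condExp τ A)) (restrict hB (φ ∘ₗ condExp τ A)))

/-- `H_φ(A) = sup ∑ᵢ (η(φᵢ(1)) + S(φᵢ|_A, φ|_A))` over all finite decompositions of `φ`, where
`η(t) = -t log t`. -/
def entH (φ : Functional M) (hA : A ≤ M) : EReal :=
  ⨆ (k : ℕ) (f : Fin k → Functional M) (_ : f ∈ decomp φ k),
    ∑ i, ((Real.negMulLog (f i 1).re : EReal)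
      + relEntropy (restrict hA (f i)) (restrict hA φ))

/-- `h_φ(A) = sup ∑ᵢ (η(φᵢ(1)) + S(φᵢ|_A, φ|_A))` over the families `(φᵢ) ∈ decompInv τ φ A`. -/
def enth (τ φ : Functional M) (hA : A ≤ M) : EReal :=
  ⨆ (k : ℕ) (g : Fin k → Functional M) (_ : g ∈ decompInv τ φ A k),
    ∑ i, ((Real.negMulLog (g i 1).re : EReal)
      + relEntropy (restrict hA (g i)) (restrict hA φ))

end VNEntropy

end

/-! Everything rests on one feature of the variational formula: any map `g` between the algebras,
linear or not, that does not increase the two quadratic forms carries competitors to competitors, so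
it can only raise the relative entropy (`relEntropy_le_of_map`). An inclusion gives monotonicity
under restriction. The Schwarz inequality for `E_A` gives the reverse bound: if `E_A` maps `B` into
`A ∩ B`, as it does when `E_A` and `E_B` commute, then the entropy of `ψ ∘ E_A` on `B` equals that
of `ψ` on `A ∩ B` (`relEntropy_restrict_comp`).

Two more inputs are needed. On `ℂ1` the formula evaluates to `p log p` with `p = ψ(1)`
(`relEntropy_scalars`), so subtracting the entropy on `ℂ1` adds `η(ψ(1))`. And `E_A` must exist: it
is the orthogonal projection for the trace inner product (`exists_isCondExp`).

The four claims then follow termwise, from monotonicity, from `E_A` fixing `A`, and in (3) from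
replacing `φᵢ` by `φᵢ ∘ E_A`. No infinite value is ever cancelled. -/

namespace VNEntropy

/-! ### Comparison of relative entropies on different algebras -/

section RelativeEntropy

theorem IsStep.comp {C D : Type*} {x : ℝ → C} (hx : IsStep x) (g : C → D) : IsStep (g ∘ x) := by
  refine ⟨?_, fun c => ?_⟩
  · rw [Set.range_comp]
    exact hx.1.image g
  · have : g ∘ x ⁻¹' {c} = ⋃ d ∈ (g ⁻¹' {c} ∩ Set.range x), x ⁻¹' {d} := by
      ext t
      simp
    rw [this]
    exact (hx.1.subset Set.inter_subset_right).measurableSet_biUnion fun d _ => hx.2 d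

variable {C D : Type*} [Ring C] [StarRing C] [Algebra ℂ C] [Ring D] [StarRing D] [Algebra ℂ D]

/-- A map which decreases both quadratic forms in the variational formula increases the relative
entropy. -/
theorem relEntropy_le_of_map (g : C → D) {ψ φ : C →ₗ[ℂ] ℂ} {ψ' φ' : D →ₗ[ℂ] ℂ}
    (h1 : ψ 1 = ψ' 1)
    (hψ : ∀ x, (ψ' (star (1 - g x) * (1 - g x))).re ≤ (ψ (star (1 - x) * (1 - x))).re)
    (hφ : ∀ x, (φ' (g x * star (g x))).re ≤ (φ (x * star x)).re) :
    relEntropy ψ φ ≤ relEntropy ψ' φ' := by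
  refine iSup₂_le fun n hn => iSup₂_le fun x hx => ?_
  refine le_trans ?_ (le_iSup₂_of_le n hn (le_iSup₂_of_le (g ∘ x) (hx.comp g) le_rfl))
  rw [h1]
  refine EReal.sub_le_sub le_rfl ?_
  rw [EReal.coe_ennreal_le_coe_ennreal_iff]
  refine setLIntegral_mono_ae' measurableSet_Ioi (Filter.Eventually.of_forall fun t ht => ?_)
  have ht0 : 0 < t := lt_of_le_of_lt (by positivity) (Set.mem_Ioi.1 ht)
  refine ENNReal.ofReal_le_ofReal ?_
  have h3 := hψ (x t)
  have h4 := hφ (x t)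
  simp only [Function.comp_apply]
  gcongr

end RelativeEntropy

/-! ### Relative entropy on the scalars -/

section Scalar

open Filter Topology

/-- The pointwise minimum of the integrand for scalars. -/
theorem scalar_integrand_ge {p t : ℝ} (hp : 0 ≤ p) (ht : 0 < t) (z : ℂ) :
    p / (t * (p * t + 1)) ≤ (p * Complex.normSq (1 - z) + 1 / t * Complex.normSq z) / t := by
  have h : 0 < p * t + 1 := by positivity
  rw [div_le_div_iff₀ (by positivity) ht]
  simp only [Complex.normSq_apply, Complex.sub_re, Complex.sub_im, Complex.one_re, Complex.one_im]
  -- Completing the square at the minimiser `z = p t / (p t + 1)`.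
  have : (p * ((1 - z.re) * (1 - z.re) + (0 - z.im) * (0 - z.im))
      + 1 / t * (z.re * z.re + z.im * z.im)) * (t * (p * t + 1)) - p * t
      = ((p * t + 1) * z.re - p * t) ^ 2 + (p * t + 1) ^ 2 * z.im ^ 2 := by
    field_simp
    ring
  nlinarith [sq_nonneg ((p * t + 1) * z.re - p * t), sq_nonneg ((p * t + 1) * z.im)]

/-- The integrand has the antiderivative `-p log (p + 1/t)`. -/
theorem lintegral_scalar_min {p : ℝ} (hp : 0 < p) {n : ℕ} (hn : 1 ≤ n) :
    ∫⁻ t in Set.Ioi (1 / (n : ℝ)), ENNReal.ofReal (p / (t * (p * t + 1)))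
      = ENNReal.ofReal (p * (Real.log (p + n) - Real.log p)) := by
  have hn0 : (0 : ℝ) < n := by exact_mod_cast hn
  have hd : ∀ t ∈ Set.Ici (1 / (n : ℝ)),
      HasDerivAt (fun t => -p * Real.log (p + t⁻¹)) (p / (t * (p * t + 1))) t := by
    intro t ht
    have ht0 : 0 < t := lt_of_lt_of_le (by positivity) (Set.mem_Ici.1 ht)
    have h := (((hasDerivAt_inv ht0.ne').const_add p).log (by positivity)).const_mul (-p)
    refine h.congr_deriv ?_
    field_simp
  have hpos : ∀ t ∈ Set.Ioi (1 / (n : ℝ)), 0 ≤ p / (t * (p * t + 1)) := by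
    intro t ht
    have ht0 : 0 < t := lt_of_le_of_lt (by positivity) (Set.mem_Ioi.1 ht)
    positivity
  have hl : Tendsto (fun t : ℝ => -p * Real.log (p + t⁻¹)) atTop (𝓝 (-p * Real.log p)) := by
    have : Tendsto (fun t : ℝ => p + t⁻¹) atTop (𝓝 p) := by
      simpa using tendsto_inv_atTop_zero.const_add p
    exact (this.log hp.ne').const_mul _
  have hi := integrableOn_Ioi_deriv_of_nonneg' hd hpos hl
  have he := integral_Ioi_of_hasDerivAt_of_nonneg' hd hpos hl
  rw [← ofReal_integral_eq_lintegral_ofReal hi ((ae_restrict_iff' measurableSet_Ioi).2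
    (Eventually.of_forall hpos)), he]
  congr 1
  rw [one_div, inv_inv]
  ring

/-- Simple functions decreasing to the minimiser `p t / (p t + 1)`. -/
noncomputable def ceilStep (p : ℝ) (k : ℕ) (t : ℝ) : ℕ :=
  ⌈((k : ℝ) + 1) * (p * |t| / (p * |t| + 1))⌉₊

theorem measurable_ceilStep (p : ℝ) (k : ℕ) : Measurable (ceilStep p k) := by
  unfold ceilStep
  fun_prop

theorem ceilStep_le {p : ℝ} (hp : 0 ≤ p) (k : ℕ) (t : ℝ) : ceilStep p k t ≤ k + 1 := by
  refine Nat.ceil_le.2 ?_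
  push_cast
  refine mul_le_of_le_one_right (by positivity) ?_
  rw [div_le_one (by positivity)]
  linarith

/-- The exact minimiser is not a step function, so it is rounded up to multiples of `1 / (k + 1)`.
Rounding up keeps `1 - y ≤ 1 / (p t + 1)`, which bounds the integrand by `2 / t²` uniformly in `k`;
dominated convergence applies. -/
theorem tendsto_lintegral_ceilStep {p : ℝ} (hp : 0 < p) {n : ℕ} (hn : 1 ≤ n) :
    Tendsto (fun k : ℕ => ∫⁻ t in Set.Ioi (1 / (n : ℝ)), ENNReal.ofReal
        ((p * (1 - ceilStep p k t / ((k : ℝ) + 1)) ^ 2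
          + 1 / t * (ceilStep p k t / ((k : ℝ) + 1)) ^ 2) / t)) atTop
      (𝓝 (ENNReal.ofReal (p * (Real.log (p + n) - Real.log p)))) := by
  have hn0 : (0 : ℝ) < n := by exact_mod_cast hn
  rw [← lintegral_scalar_min hp hn]
  have hbd : ∀ t : ℝ, 0 < t → ∀ k : ℕ, p * t / (p * t + 1) ≤ ceilStep p k t / ((k : ℝ) + 1) ∧
      (ceilStep p k t : ℝ) / ((k : ℝ) + 1) ≤ 1 ∧
      (ceilStep p k t : ℝ) / ((k : ℝ) + 1) ≤ p * t / (p * t + 1) + 1 / ((k : ℝ) + 1) := by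
    intro t ht k
    have hk : (0 : ℝ) < (k : ℝ) + 1 := by positivity
    refine ⟨?_, ?_, ?_⟩
    · rw [le_div_iff₀ hk, mul_comm]
      have := Nat.le_ceil (((k : ℝ) + 1) * (p * |t| / (p * |t| + 1)))
      simpa [ceilStep, abs_of_pos ht] using this
    · rw [div_le_one hk]
      exact_mod_cast ceilStep_le hp.le k t
    · have := Nat.ceil_lt_add_one (a := ((k : ℝ) + 1) * (p * |t| / (p * |t| + 1))) (by positivity)
      rw [div_add_div _ _ (by positivity) hk.ne', div_le_div_iff₀ hk (by positivity)]
      have h2 : (ceilStep p k t : ℝ) ≤ ((k : ℝ) + 1) * (p * t / (p * t + 1)) + 1 := by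
        simpa [ceilStep, abs_of_pos ht] using this.le
      have h3 : (ceilStep p k t : ℝ) * (p * t + 1) ≤ ((k : ℝ) + 1) * (p * t) + (p * t + 1) := by
        calc _ ≤ (((k : ℝ) + 1) * (p * t / (p * t + 1)) + 1) * (p * t + 1) := by gcongr
          _ = _ := by field_simp
      nlinarith
  refine tendsto_lintegral_of_dominated_convergence (fun t => ENNReal.ofReal (2 * t ^ (-2 : ℝ)))
    ?_ ?_ ?_ ?_
  · intro k
    have := measurable_ceilStep p k
    have h2 : Measurable fun t => (ceilStep p k t : ℝ) := measurable_from_nat.comp this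
    fun_prop
  · intro k
    refine (ae_restrict_iff' measurableSet_Ioi).2 (Eventually.of_forall fun t ht => ?_)
    have ht0 : 0 < t := lt_of_le_of_lt (by positivity) (Set.mem_Ioi.1 ht)
    refine ENNReal.ofReal_le_ofReal ?_
    obtain ⟨h1, h2, -⟩ := hbd t ht0 k
    set y := (ceilStep p k t : ℝ) / ((k : ℝ) + 1)
    have hy : 0 ≤ y := by positivity
    have h3 : 1 - y ≤ 1 / (p * t + 1) := by
      have : 1 / (p * t + 1) = 1 - p * t / (p * t + 1) := by field_simp; ring
      linarith
    have h4 : p * (1 - y) ^ 2 ≤ 1 / t := by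
      calc p * (1 - y) ^ 2 ≤ p * (1 / (p * t + 1)) ^ 2 := by
            have : 0 ≤ 1 - y := by linarith
            gcongr
        _ ≤ 1 / t := by
            rw [div_pow, one_pow, mul_one_div, div_le_div_iff₀ (by positivity) ht0]
            nlinarith [mul_pos hp ht0]
    have h5 : 1 / t * y ^ 2 ≤ 1 / t := mul_le_of_le_one_right (by positivity) (by nlinarith)
    have h6 : 2 * t ^ (-2 : ℝ) = (1 / t + 1 / t) / t := by
      rw [Real.rpow_neg ht0.le, Real.rpow_two]
      field_simp
      norm_num
    rw [h6]
    gcongr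
  · have h := (integrableOn_Ioi_rpow_of_lt (a := -2) (by norm_num)
      (show (0 : ℝ) < 1 / n by positivity)).const_mul 2
    exact ((hasFiniteIntegral_iff_ofReal ((ae_restrict_iff' measurableSet_Ioi).2
      (Eventually.of_forall fun t ht => by
        have ht0 : 0 < t := lt_of_le_of_lt (by positivity) (Set.mem_Ioi.1 ht)
        simp only [Pi.zero_apply]
        positivity))).1 h.2).ne
  · refine (ae_restrict_iff' measurableSet_Ioi).2 (Eventually.of_forall fun t ht => ?_)
    have ht0 : 0 < t := lt_of_le_of_lt (by positivity) (Set.mem_Ioi.1 ht)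
    refine ENNReal.tendsto_ofReal ?_
    have hy : Tendsto (fun k : ℕ => (ceilStep p k t : ℝ) / ((k : ℝ) + 1)) atTop
        (𝓝 (p * t / (p * t + 1))) := by
      refine tendsto_of_tendsto_of_tendsto_of_le_of_le tendsto_const_nhds ?_
        (fun k => (hbd t ht0 k).1) (fun k => (hbd t ht0 k).2.2)
      simpa using tendsto_one_div_add_atTop_nhds_zero_nat.const_add (p * t / (p * t + 1))
    have := ((((hy.const_sub 1).pow 2).const_mul p).add ((hy.pow 2).const_mul (1 / t))).div_const t
    convert this using 2
    have : p * t + 1 ≠ 0 := by positivity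
    field_simp
    ring

variable {H : Type*} [NormedAddCommGroup H] [InnerProductSpace ℂ H] [CompleteSpace H]

theorem exists_eq_algebraMap (x : (scalars H).toStarSubalgebra) :
    ∃ z : ℂ, x = algebraMap ℂ _ z := by
  obtain ⟨c, hc⟩ := StarSubalgebra.mem_bot.1 x.2
  exact ⟨c, Subtype.ext hc.symm⟩

theorem map_algebraMap_mul_star (ψ : Functional (scalars H)) (z : ℂ) :
    ψ (algebraMap ℂ _ z * star (algebraMap ℂ _ z)) = Complex.normSq z * ψ 1 := by
  rw [← algebraMap_star_comm, ← map_mul, Algebra.algebraMap_eq_smul_one, map_smul, smul_eq_mul]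
  congr 1
  exact Complex.mul_conj z

/-- For fixed `n` the pointwise minimum bounds the bracket above by `p log n - p (log (p + n) - log
p) ≤ p log p`. The rounded minimisers attain the middle value in the limit, and it tends to `p log
p` as `n → ∞`. -/
theorem relEntropy_scalars {ψ φ : Functional (scalars H)} {p : ℝ} (hp : 0 ≤ p)
    (hψ : ψ 1 = p) (hφ : φ 1 = 1) : relEntropy ψ φ = ((-Real.negMulLog p : ℝ) : EReal) := by
  have key : ∀ (t : ℝ) (z : ℂ), ((ψ (star (1 - algebraMap ℂ _ z) * (1 - algebraMap ℂ _ z))).re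
      + 1 / t * (φ (algebraMap ℂ _ z * star (algebraMap ℂ _ z))).re) / t
      = (p * Complex.normSq (1 - z) + 1 / t * Complex.normSq z) / t := by
    intro t z
    have : star (1 - algebraMap ℂ (scalars H).toStarSubalgebra z) * (1 - algebraMap ℂ _ z)
        = algebraMap ℂ _ (1 - z) * star (algebraMap ℂ _ (1 - z)) := by
      rw [map_sub, map_one, ← map_one (algebraMap ℂ (scalars H).toStarSubalgebra), ← map_sub,
        ← algebraMap_star_comm, ← map_mul, ← map_mul, mul_comm]
    rw [this, map_algebraMap_mul_star, map_algebraMap_mul_star, hψ, hφ]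
    simp [mul_comm]
  apply le_antisymm
  · refine iSup₂_le fun n hn => iSup₂_le fun x hx => ?_
    have hn0 : (0 : ℝ) < n := by exact_mod_cast hn
    rw [hψ, Complex.ofReal_re]
    rcases hp.eq_or_lt with rfl | hp'
    · simp [EReal.coe_ennreal_nonneg]
    have h1 : ENNReal.ofReal (p * (Real.log (p + n) - Real.log p)) ≤ kosakiIntegral ψ φ n x := by
      rw [← lintegral_scalar_min hp' hn]
      refine setLIntegral_mono_ae' measurableSet_Ioi (Eventually.of_forall fun t ht => ?_)
      have ht0 : 0 < t := lt_of_le_of_lt (by positivity) (Set.mem_Ioi.1 ht)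
      obtain ⟨z, hz⟩ := exists_eq_algebraMap (x t)
      rw [hz, key]
      exact ENNReal.ofReal_le_ofReal (scalar_integrand_ge hp ht0 z)
    have hlog : Real.log p ≤ Real.log (p + n) := Real.log_le_log hp' (by linarith)
    have hlog2 : Real.log n ≤ Real.log (p + n) := Real.log_le_log hn0 (by linarith)
    calc _ ≤ ((p * Real.log n : ℝ) : EReal)
          - (ENNReal.ofReal (p * (Real.log (p + n) - Real.log p)) : EReal) :=
        EReal.sub_le_sub le_rfl (EReal.coe_ennreal_le_coe_ennreal_iff.2 h1)
      _ ≤ _ := by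
        rw [EReal.coe_ennreal_ofReal, max_eq_left (mul_nonneg hp (sub_nonneg.2 hlog)),
          ← EReal.coe_sub, EReal.coe_le_coe_iff, Real.negMulLog]
        nlinarith
  · rcases hp.eq_or_lt with rfl | hp'
    -- For `p = 0` the competitor `x = 0` already gives the value `0`.
    · refine le_iSup₂_of_le 1 le_rfl (le_iSup₂_of_le (fun _ => 0) ⟨?_, ?_⟩ ?_)
      · exact (Set.finite_singleton 0).subset (by rintro _ ⟨_, rfl⟩; rfl)
      · intro c
        exact MeasurableSet.const _
      · have : kosakiIntegral ψ φ 1 (fun _ => 0) = 0 := by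
          unfold kosakiIntegral
          simp [hψ]
        simp [this]
    have hle : ∀ n : ℕ, 1 ≤ n → ((p * Real.log n - p * (Real.log (p + n) - Real.log p) : ℝ) : EReal)
        ≤ relEntropy ψ φ := by
      intro n hn
      have hlog : Real.log p ≤ Real.log (p + n) := Real.log_le_log hp' (by simp)
      have ht := tendsto_lintegral_ceilStep hp' hn
      have hte : Tendsto (fun k : ℕ => ((p * Real.log n : ℝ) : EReal) -
          ((∫⁻ t in Set.Ioi (1 / (n : ℝ)), ENNReal.ofReal
        ((p * (1 - ceilStep p k t / ((k : ℝ) + 1)) ^ 2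
          + 1 / t * (ceilStep p k t / ((k : ℝ) + 1)) ^ 2) / t) : ℝ≥0∞) : EReal)) atTop
          (𝓝 (((p * Real.log n : ℝ) : EReal) -
            (ENNReal.ofReal (p * (Real.log (p + n) - Real.log p)) : EReal))) := by
        have h1 := (continuous_coe_ennreal_ereal.tendsto _).comp ht
        have h2 := ((continuous_neg (G := EReal)).tendsto _).comp h1
        -- Addition on `EReal` is continuous here because the first summand is finite.
        have h3 := (EReal.continuousAt_add (p := (((p * Real.log n : ℝ) : EReal),
          -(ENNReal.ofReal (p * (Real.log (p + n) - Real.log p)) : EReal)))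
          (Or.inl (EReal.coe_ne_top _)) (Or.inl (EReal.coe_ne_bot _)))
        exact h3.tendsto.comp (tendsto_const_nhds.prodMk_nhds h2)
      rw [EReal.coe_ennreal_ofReal, max_eq_left (mul_nonneg hp (sub_nonneg.2 hlog)),
          ← EReal.coe_sub] at hte
      refine le_of_tendsto hte (Eventually.of_forall fun k => ?_)
      refine le_iSup₂_of_le n hn (le_iSup₂_of_le
        (fun t => algebraMap ℂ _ (((ceilStep p k t : ℝ) / ((k : ℝ) + 1) : ℝ) : ℂ)) ⟨?_, ?_⟩ ?_)
      · refine ((Finset.range (k + 2)).finite_toSet.image (fun m : ℕ =>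
          algebraMap ℂ (scalars H).toStarSubalgebra (((m : ℝ) / ((k : ℝ) + 1) : ℝ) : ℂ))).subset ?_
        rintro _ ⟨t, rfl⟩
        refine ⟨ceilStep p k t, ?_, rfl⟩
        have := ceilStep_le hp k t
        simp
        omega
      · intro c
        exact (measurable_ceilStep p k) (t := (fun m : ℕ =>
          algebraMap ℂ (scalars H).toStarSubalgebra (((m : ℝ) / ((k : ℝ) + 1) : ℝ) : ℂ)) ⁻¹' {c})
          trivial
      · rw [hψ, Complex.ofReal_re]
        refine EReal.sub_le_sub le_rfl (le_of_eq ?_)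
        unfold kosakiIntegral
        congr 2
        ext t
        rw [key, ← Complex.ofReal_one, ← Complex.ofReal_sub, Complex.normSq_ofReal,
          Complex.normSq_ofReal, pow_two, pow_two]
    have hl : Tendsto (fun n : ℕ => p * Real.log n - p * (Real.log (p + n) - Real.log p)) atTop
        (𝓝 (-Real.negMulLog p)) := by
      have h1 : Tendsto (fun n : ℕ => p / n + 1) atTop (𝓝 1) := by
        simpa using (tendsto_const_div_atTop_nhds_zero_nat p).add_const 1
      have h2 := ((h1.log one_ne_zero).const_mul (-p)).add_const (p * Real.log p)
      rw [Real.log_one, mul_zero, zero_add] at h2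
      rw [Real.negMulLog, neg_mul, neg_neg]
      refine h2.congr' ?_
      filter_upwards [eventually_ge_atTop 1] with n hn
      have hn0 : (0 : ℝ) < n := by exact_mod_cast hn
      have : p + n = n * (p / n + 1) := by field_simp
      rw [this, Real.log_mul hn0.ne' (by positivity)]
      ring
    refine le_of_tendsto ((continuous_coe_real_ereal.tendsto _).comp hl) ?_
    filter_upwards [eventually_ge_atTop 1] with n hn using hle n hn

end Scalar

end VNEntropy

namespace VNEntropy

variable {H : Type*} [NormedAddCommGroup H] [InnerProductSpace ℂ H] [CompleteSpace H]

/-! ### Weak compactness, and weak closedness of von Neumann algebras -/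

section WeakLimit

open Filter Topology

/-- A bounded sequence of operators converges weakly along an ultrafilter. -/
theorem exists_weak_limit (U : Ultrafilter ℕ) (a : ℕ → H →L[ℂ] H) (ha : ∀ n, ‖a n‖ ≤ 1) :
    ∃ T : H →L[ℂ] H, ∀ ξ η, Tendsto (fun n => inner ℂ (a n ξ) η) U (𝓝 (inner ℂ (T ξ) η)) := by
  have hb : ∀ n ξ η, ‖inner ℂ (a n ξ) η‖ ≤ 1 * ‖ξ‖ * ‖η‖ := fun n ξ η =>
    (norm_inner_le_norm _ _).trans (by gcongr; exact (a n).le_of_opNorm_le (ha n) ξ)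
  have hlim : ∀ ξ η : H, ∃ z : ℂ, ‖z‖ ≤ 1 * ‖ξ‖ * ‖η‖ ∧
      Tendsto (fun n => inner ℂ (a n ξ) η) U (𝓝 z) := by
    intro ξ η
    -- Each matrix coefficient stays in a compact disc, so the ultrafilter picks a limit. The limits
    -- form a bounded sesquilinear form, which is represented by an operator.
    obtain ⟨z, hz, hle⟩ := (isCompact_closedBall (0 : ℂ) (1 * ‖ξ‖ * ‖η‖)).ultrafilter_le_nhds
      (U.map fun n => inner ℂ (a n ξ) η) (by
        rw [le_principal_iff]
        exact Eventually.of_forall (f := (U : Filter ℕ)) fun n => mem_closedBall_zero_iff.2 (hb _ ξ η))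
    exact ⟨z, by simpa using hz, hle⟩
  choose L hLb hL using hlim
  let B : H →L⋆[ℂ] H →L[ℂ] ℂ := LinearMap.mkContinuous₂
    (LinearMap.mk₂'ₛₗ (starRingEnd ℂ) (RingHom.id ℂ) L
      (fun ξ ξ' η => tendsto_nhds_unique (hL _ _) (by
        simpa only [map_add, inner_add_left] using (hL ξ η).add (hL ξ' η)))
      (fun c ξ η => tendsto_nhds_unique (hL _ _) (by
        simpa only [map_smul, inner_smul_left, smul_eq_mul] using (hL ξ η).const_mul (starRingEnd ℂ c)))
      (fun ξ η η' => tendsto_nhds_unique (hL _ _) (by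
        simpa only [inner_add_right] using (hL ξ η).add (hL ξ η')))
      (fun c ξ η => tendsto_nhds_unique (hL _ _) (by
        simpa only [inner_smul_right, smul_eq_mul, RingHom.id_apply] using (hL ξ η).const_mul c))) 1 hLb
  refine ⟨InnerProductSpace.continuousLinearMapOfBilin B, fun ξ η => ?_⟩
  rw [InnerProductSpace.continuousLinearMapOfBilin_apply]
  exact hL ξ η

theorem isSelfAdjoint_of_weak_limit {U : Ultrafilter ℕ} {a : ℕ → H →L[ℂ] H}
    (ha : ∀ n, IsSelfAdjoint (a n)) {T : H →L[ℂ] H}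
    (hT : ∀ ξ η, Tendsto (fun n => inner ℂ (a n ξ) η) U (𝓝 (inner ℂ (T ξ) η))) :
    IsSelfAdjoint T := by
  rw [ContinuousLinearMap.isSelfAdjoint_iff_isSymmetric]
  intro ξ η
  refine tendsto_nhds_unique (hT ξ η) ?_
  have h := (Complex.continuous_conj.tendsto _).comp (hT η ξ)
  simp only [Function.comp_def, inner_conj_symm] at h
  refine h.congr fun n => ?_
  exact ((ContinuousLinearMap.isSelfAdjoint_iff_isSymmetric.1 (ha n)) ξ η).symm

/-- `A` is its own bicommutant, and commuting with a fixed operator passes to weak limits. -/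
theorem mem_of_weak_limit {A : VonNeumannAlgebra H} {U : Ultrafilter ℕ} {a : ℕ → H →L[ℂ] H}
    (ha : ∀ n, a n ∈ A) {T : H →L[ℂ] H}
    (hT : ∀ ξ η, Tendsto (fun n => inner ℂ (a n ξ) η) U (𝓝 (inner ℂ (T ξ) η))) : T ∈ A := by
  rw [← VonNeumannAlgebra.commutant_commutant A, VonNeumannAlgebra.mem_commutant_iff]
  intro g hg
  rw [VonNeumannAlgebra.mem_commutant_iff] at hg
  ext ξ
  refine ext_inner_right ℂ fun η => ?_
  refine tendsto_nhds_unique (f := fun n => inner ℂ (a n ξ) (ContinuousLinearMap.adjoint g η))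
    (l := (U : Filter ℕ)) ?_ ?_
  · have h := hT ξ (ContinuousLinearMap.adjoint g η)
    rwa [ContinuousLinearMap.adjoint_inner_right] at h
  · refine (hT (g ξ) η).congr fun n => ?_
    rw [ContinuousLinearMap.adjoint_inner_right]
    have := congrArg (fun S : H →L[ℂ] H => S ξ) (hg (a n) (ha n))
    change (a n) (g ξ) = g (a n ξ) at this
    rw [this]

theorem cfc_mem {A : VonNeumannAlgebra H} {a : H →L[ℂ] H} (ha : a ∈ A) (f : ℝ → ℝ) :
    cfc f a ∈ A := by
  rw [← VonNeumannAlgebra.commutant_commutant A, VonNeumannAlgebra.mem_commutant_iff]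
  intro g hg
  rw [VonNeumannAlgebra.mem_commutant_iff] at hg
  have h : Commute a g := hg a ha
  exact (h.cfc_real f).symm.eq

end WeakLimit

variable {M A B : VonNeumannAlgebra H}

/-- Dominated convergence in the series defining normality: for contractions the terms are dominated
by `‖y‖ (‖ξₖ‖² + ‖ηₖ‖²)`. -/
theorem IsNormal.tendsto {τ : Functional M} (hτ : IsNormal τ) {l : Filter ℕ}
    {a : ℕ → M.toStarSubalgebra} (ha : ∀ n, ‖(a n : H →L[ℂ] H)‖ ≤ 1) {T : M.toStarSubalgebra}
    (hT : ∀ ξ η, Filter.Tendsto (fun n => inner ℂ ((a n : H →L[ℂ] H) ξ) η) l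
      (nhds (inner ℂ ((T : H →L[ℂ] H) ξ) η))) (y : M.toStarSubalgebra) :
    Filter.Tendsto (fun n => τ (a n * y)) l (nhds (τ (T * y))) := by
  obtain ⟨ξ, η, hξ, hη, h⟩ := hτ
  rw [← (h (T * y)).tsum_eq]
  simp_rw [← fun n => (h (a n * y)).tsum_eq]
  refine tendsto_tsum_of_dominated_convergence
    (bound := fun k => ‖(y : H →L[ℂ] H)‖ * (‖ξ k‖ ^ 2 + ‖η k‖ ^ 2)) ((hξ.add hη).mul_left _)
    (fun k => ?_) (Filter.Eventually.of_forall fun n k => ?_)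
  · have h2 := (Complex.continuous_conj.tendsto _).comp (hT ((y : H →L[ℂ] H) (ξ k)) (η k))
    simp only [Function.comp_def, inner_conj_symm] at h2
    exact h2
  · have h1 : ‖(a n : H →L[ℂ] H) ((y : H →L[ℂ] H) (ξ k))‖ ≤ ‖(y : H →L[ℂ] H)‖ * ‖ξ k‖ := by
      refine ((a n : H →L[ℂ] H).le_of_opNorm_le (ha n) _).trans ?_
      rw [one_mul]
      exact (y : H →L[ℂ] H).le_opNorm _
    have h2 := norm_inner_le_norm (𝕜 := ℂ) (η k) ((a n : H →L[ℂ] H) ((y : H →L[ℂ] H) (ξ k)))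
    have h3 : 0 ≤ ‖(y : H →L[ℂ] H)‖ := norm_nonneg _
    calc _ ≤ ‖η k‖ * (‖(y : H →L[ℂ] H)‖ * ‖ξ k‖) := h2.trans (by gcongr)
      _ = ‖(y : H →L[ℂ] H)‖ * (‖ξ k‖ * ‖η k‖) := by ring
      _ ≤ _ := by
        gcongr
        nlinarith [sq_nonneg (‖ξ k‖ - ‖η k‖), sq_nonneg (‖ξ k‖ + ‖η k‖)]

/-! ### Positive and tracial functionals -/

section Functional

variable {C : Type*} [Ring C] [StarRing C] [Algebra ℂ C]

/-- Polarisation: `ψ` is real on `star a * a` for `a = 1, x, 1 + x, 1 + i x`. -/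
theorem IsPositive.map_star [StarModule ℂ C] {ψ : C →ₗ[ℂ] ℂ} (hψ : IsPositive ψ) (x : C) :
    ψ (star x) = star (ψ x) := by
  have h0 := (Complex.nonneg_iff.1 (hψ 1)).2
  have hx := (Complex.nonneg_iff.1 (hψ x)).2
  have h1 := (Complex.nonneg_iff.1 (hψ (1 + x))).2
  have h2 := (Complex.nonneg_iff.1 (hψ (1 + Complex.I • x))).2
  simp only [star_add, star_one, star_smul, add_mul, mul_add, one_mul, mul_one, map_add,
    smul_mul_assoc, mul_smul_comm, map_smul, smul_eq_mul, Complex.star_def, Complex.conj_I,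
    Complex.add_im, Complex.mul_im, Complex.mul_re, Complex.neg_re, Complex.neg_im, Complex.I_re,
    Complex.I_im] at h0 h1 h2 hx
  apply Complex.ext <;> simp <;> linarith

/-- By cyclicity this is the trace of `star c * c` with `c = s * star r`. -/
theorem tracial_mul_nonneg {τ : C →ₗ[ℂ] ℂ} (hτ : IsPositive τ)
    (ht : ∀ x y, τ (x * y) = τ (y * x)) (s r : C) : 0 ≤ τ (star s * s * (star r * r)) := by
  rw [← mul_assoc, ht]
  convert hτ (s * star r) using 2
  simp [mul_assoc]

end Functional

/-- A von Neumann subalgebra `A` seen inside `M`. -/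
noncomputable def subalg (M A : VonNeumannAlgebra H) : StarSubalgebra ℂ M.toStarSubalgebra :=
  A.toStarSubalgebra.comap M.toStarSubalgebra.subtype

/-! ### Functional calculus inside a von Neumann algebra -/

theorem isSelfAdjoint_coe {x : M.toStarSubalgebra} (hx : IsSelfAdjoint x) :
    IsSelfAdjoint (x : H →L[ℂ] H) := by
  exact congrArg Subtype.val hx

/-- The continuous functional calculus in a von Neumann algebra. -/
noncomputable def fc (f : ℝ → ℝ) (x : M.toStarSubalgebra) : M.toStarSubalgebra :=
  ⟨cfc f (x : H →L[ℂ] H), cfc_mem x.2 f⟩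

theorem fc_mem {x : M.toStarSubalgebra} (hx : x ∈ subalg M A) (f : ℝ → ℝ) :
    fc f x ∈ subalg M A := cfc_mem (A := A) hx f

theorem isSelfAdjoint_fc (f : ℝ → ℝ) (x : M.toStarSubalgebra) : IsSelfAdjoint (fc f x) := by
  apply Subtype.ext
  exact (cfc_predicate f (x : H →L[ℂ] H) : IsSelfAdjoint _)

theorem fc_mul {x : M.toStarSubalgebra} {f g : ℝ → ℝ} (hf : Continuous f) (hg : Continuous g) :
    fc f x * fc g x = fc (fun t => f t * g t) x :=
  Subtype.ext (cfc_mul f g (x : H →L[ℂ] H) hf.continuousOn hg.continuousOn).symm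

theorem fc_add {x : M.toStarSubalgebra} {f g : ℝ → ℝ} (hf : Continuous f) (hg : Continuous g) :
    fc f x + fc g x = fc (fun t => f t + g t) x :=
  Subtype.ext (cfc_add (x : H →L[ℂ] H) f g hf.continuousOn hg.continuousOn).symm

theorem fc_neg {x : M.toStarSubalgebra} (f : ℝ → ℝ) :
    -fc f x = fc (fun t => -f t) x :=
  Subtype.ext (cfc_neg f (x : H →L[ℂ] H)).symm

theorem fc_sub {x : M.toStarSubalgebra} {f g : ℝ → ℝ} (hf : Continuous f) (hg : Continuous g) :
    fc f x - fc g x = fc (fun t => f t - g t) x :=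
  Subtype.ext (cfc_sub f g (x : H →L[ℂ] H) hf.continuousOn hg.continuousOn).symm

theorem fc_id {x : M.toStarSubalgebra} (hx : IsSelfAdjoint x) : fc (fun t => t) x = x :=
  Subtype.ext (cfc_id' ℝ (x : H →L[ℂ] H) (isSelfAdjoint_coe hx))

theorem fc_one {x : M.toStarSubalgebra} (hx : IsSelfAdjoint x) : fc (fun _ => 1) x = 1 :=
  Subtype.ext (cfc_const_one ℝ (x : H →L[ℂ] H) (isSelfAdjoint_coe hx))

/-- Nonnegative functions give elements of the form `s⋆ s`. -/
theorem fc_eq_star_mul_self {f : ℝ → ℝ} (hf : Continuous f) (h0 : ∀ t, 0 ≤ f t)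
    (x : M.toStarSubalgebra) :
    fc f x = star (fc (fun t => √(f t)) x) * fc (fun t => √(f t)) x := by
  rw [(isSelfAdjoint_fc _ x).star_eq, fc_mul (by fun_prop) (by fun_prop)]
  simp_rw [Real.mul_self_sqrt (h0 _)]

theorem one_add_eq_star_mul_self {x : M.toStarSubalgebra} (hx : IsSelfAdjoint x)
    (h1 : ‖(x : H →L[ℂ] H)‖ ≤ 1) : ∃ r : M.toStarSubalgebra, 1 + x = star r * r := by
  refine ⟨fc (fun t => √(1 + t)) x, ?_⟩
  rw [(isSelfAdjoint_fc _ x).star_eq, fc_mul (by fun_prop) (by fun_prop)]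
  have h2 : (1 : M.toStarSubalgebra) + x = fc (fun t => 1 + t) x := by
    rw [← fc_add continuous_const continuous_id', fc_one hx, fc_id hx]
  rw [h2]
  refine Subtype.ext (cfc_congr fun t ht => ?_)
  have h3 : ‖t‖ ≤ 1 := by
    rcases subsingleton_or_nontrivial (H →L[ℂ] H) with hs | hs
    · exact absurd ht (by simp [spectrum.of_subsingleton])
    · exact (spectrum.norm_le_norm_of_mem ht).trans h1
  rw [Real.mul_self_sqrt]
  have := (abs_le.1 h3).1
  linarith

/-! ### Existence of the conditional expectation -/

section CondExp

open Filter Topology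

variable {τ : Functional M}

/-- The quadratic form of the trace on self-adjoint elements. -/
theorem trace_sq_sub (hτ : IsFaithfulNormalTrace τ) (x y : M.toStarSubalgebra) :
    (τ ((x - y) * (x - y))).re
      = (τ (x * x)).re - 2 * (τ (y * x)).re + (τ (y * y)).re := by
  simp only [sub_mul, mul_sub, map_sub, hτ.tracial x y, Complex.sub_re]
  ring

theorem trace_sq_nonneg (hτ : IsFaithfulNormalTrace τ) {x : M.toStarSubalgebra}
    (hx : IsSelfAdjoint x) : 0 ≤ (τ (x * x)).re := by
  have := (Complex.nonneg_iff.1 (hτ.positive x)).1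
  rwa [hx.star_eq] at this

/-- A minimising sequence in the self-adjoint unit ball of `A` has a weak limit in `A`, and the
trace norm is weakly lower semicontinuous. -/
theorem exists_nearest_contraction (hτ : IsFaithfulNormalTrace τ) (hA : A ≤ M)
    {x : M.toStarSubalgebra} (hx : IsSelfAdjoint x) :
    ∃ h ∈ subalg M A, IsSelfAdjoint h ∧ ∀ a ∈ subalg M A, IsSelfAdjoint a →
      ‖(a : H →L[ℂ] H)‖ ≤ 1 → (τ ((x - h) * (x - h))).re ≤ (τ ((x - a) * (x - a))).re := by
  let S : Set ℝ := {d | ∃ a ∈ subalg M A, IsSelfAdjoint a ∧ ‖(a : H →L[ℂ] H)‖ ≤ 1 ∧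
    (τ ((x - a) * (x - a))).re = d}
  have hne : S.Nonempty := ⟨_, 0, zero_mem _, IsSelfAdjoint.zero _, by simp, rfl⟩
  have hbdd : BddBelow S := ⟨0, by
    rintro _ ⟨a, -, ha, -, rfl⟩
    exact trace_sq_nonneg hτ (hx.sub ha)⟩
  obtain ⟨u, -, hu, huS⟩ := exists_seq_tendsto_sInf hne hbdd
  choose a haA has ha1 hau using huS
  let U := Filter.hyperfilter ℕ
  obtain ⟨T, hT⟩ := exists_weak_limit U (fun n => (a n : H →L[ℂ] H)) ha1
  have hTA : T ∈ A := mem_of_weak_limit haA hT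
  let h : M.toStarSubalgebra := ⟨T, hA hTA⟩
  have hs : IsSelfAdjoint h :=
    Subtype.ext (isSelfAdjoint_of_weak_limit (fun n => isSelfAdjoint_coe (has n)) hT)
  refine ⟨h, hTA, hs, fun b hb hbs hb1 => ?_⟩
  have hlim : Tendsto (fun n => (τ ((x - a n) * (x - h))).re) U
      (𝓝 (τ ((x - h) * (x - h))).re) := by
    have := (hτ.normal.tendsto ha1 (T := h) hT (x - h)).const_sub (τ (x * (x - h)))
    simp_rw [← map_sub, ← sub_mul] at this
    exact (Complex.continuous_re.tendsto _).comp this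
  have hu' : Tendsto u U (𝓝 (sInf S)) := hu.mono_left (by
    rw [← Nat.cofinite_eq_atTop]
    exact Filter.hyperfilter_le_cofinite)
  -- Lower semicontinuity, from `2⟨u, v⟩ ≤ ‖u‖² + ‖v‖²` with `u = x - aₙ`, `v = x - h`.
  have hle : 2 * (τ ((x - h) * (x - h))).re ≤ sInf S + (τ ((x - h) * (x - h))).re := by
    refine le_of_tendsto_of_tendsto (hlim.const_mul 2) (hu'.add_const _)
      (Eventually.of_forall fun n => ?_)
    have h1 := trace_sq_nonneg hτ ((hx.sub hs).sub (hx.sub (has n)))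
    rw [trace_sq_sub hτ, hau] at h1
    simp only
    linarith
  have := csInf_le hbdd ⟨b, hb, hbs, hb1, rfl⟩
  linarith

/-- Truncating `a` to the interval `[-1, 1]` brings it closer to self-adjoint contractions. -/
theorem exists_contraction_closer (hτ : IsFaithfulNormalTrace τ) {x a : M.toStarSubalgebra}
    (hx : IsSelfAdjoint x) (hx1 : ‖(x : H →L[ℂ] H)‖ ≤ 1) (ha : IsSelfAdjoint a)
    (haA : a ∈ subalg M A) :
    ∃ c ∈ subalg M A, IsSelfAdjoint c ∧ ‖(c : H →L[ℂ] H)‖ ≤ 1 ∧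
      (τ ((x - c) * (x - c))).re ≤ (τ ((x - a) * (x - a))).re := by
  let f : ℝ → ℝ := fun t => max (-1) (min t 1)
  let p : ℝ → ℝ := fun t => max (-1 - t) 0
  let q : ℝ → ℝ := fun t => max (t - 1) 0
  have hf : Continuous f := by fun_prop
  have hp : Continuous p := by fun_prop
  have hq : Continuous q := by fun_prop
  -- `p` and `q` are the excesses of `a` below `-1` and above `1`; `f = -1` where `p ≠ 0` and `f =
  -- 1` where `q ≠ 0`.
  have hfpq : fc f a + (fc q a - fc p a) = a := by
    conv_rhs => rw [← fc_id ha]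
    rw [fc_sub hq hp, fc_add hf (g := fun t => q t - p t) (by fun_prop)]
    congr 1
    ext t
    simp only [f, p, q]
    rcases le_total t (-1) with h | h <;> rcases le_total t 1 with h' | h' <;>
      simp [h, h'] <;> linarith
  have hpf : fc p a * fc f a = -fc p a := by
    rw [fc_mul hp hf, fc_neg]
    congr 1
    ext t
    simp only [f, p]
    rcases le_total t (-1) with h | h
    · have : min t 1 ≤ -1 := (min_le_left _ _).trans h
      rw [max_eq_left this]
      ring
    · rw [max_eq_right (by linarith : -1 - t ≤ 0)]
      simp
  have hqf : fc q a * fc f a = fc q a := by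
    rw [fc_mul hq hf]
    congr 1
    ext t
    simp only [f, q]
    rcases le_total t 1 with h | h
    · rw [max_eq_right (by linarith : t - 1 ≤ 0)]
      simp
    · rw [min_eq_right h]
      norm_num
  refine ⟨fc f a, fc_mem haA f, isSelfAdjoint_fc f a, ?_, ?_⟩
  · refine norm_cfc_le zero_le_one fun t _ => abs_le.2 ⟨le_max_left _ _, max_le ?_ ?_⟩
    · norm_num
    · exact min_le_right _ _
  -- `p(a)(x - f(a))` has the trace of `p(a)(1 + x)`, a product of two positive elements. Likewise
  -- `q(a)` is paired with `1 - x`. So the cross term in the expanded square has the favourable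
  -- sign.
  · have h1 : 0 ≤ (τ (fc p a * (x - fc f a))).re := by
      obtain ⟨r, hr⟩ := one_add_eq_star_mul_self hx hx1
      have := tracial_mul_nonneg hτ.positive hτ.tracial (fc (fun t => √(p t)) a) r
      rw [← hr, ← fc_eq_star_mul_self hp (fun t => le_max_right _ _)] at this
      rw [mul_sub, hpf, sub_neg_eq_add, add_comm]
      rw [mul_add, mul_one] at this
      exact (Complex.nonneg_iff.1 this).1
    have h2 : (τ (fc q a * (x - fc f a))).re ≤ 0 := by
      obtain ⟨r, hr⟩ := one_add_eq_star_mul_self hx.neg (by simpa using hx1)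
      have := tracial_mul_nonneg hτ.positive hτ.tracial (fc (fun t => √(q t)) a) r
      rw [← hr, ← fc_eq_star_mul_self hq (fun t => le_max_right _ _)] at this
      rw [mul_sub, hqf]
      rw [mul_add, mul_one, mul_neg] at this
      have := (Complex.nonneg_iff.1 this).1
      simp only [map_add, map_neg, map_sub, Complex.add_re, Complex.neg_re,
        Complex.sub_re] at this ⊢
      linarith
    have h3 : x - a = (x - fc f a) - (fc q a - fc p a) := by
      conv_lhs => rw [← hfpq]
      abel
    rw [h3, trace_sq_sub hτ (x - fc f a)]
    have h4 := trace_sq_nonneg hτ ((isSelfAdjoint_fc q a).sub (isSelfAdjoint_fc p a))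
    rw [sub_mul (fc q a), map_sub, Complex.sub_re]
    linarith

/-- By truncation, the minimiser over the unit ball also minimises over all self-adjoint elements of
`A`. The first-order condition there is orthogonality of `x - h` to `A`. -/
theorem exists_projection_of_contraction (hτ : IsFaithfulNormalTrace τ) (hA : A ≤ M)
    {x : M.toStarSubalgebra} (hx : IsSelfAdjoint x) (hx1 : ‖(x : H →L[ℂ] H)‖ ≤ 1) :
    ∃ h ∈ subalg M A, ∀ b ∈ subalg M A, τ (h * b) = τ (x * b) := by
  obtain ⟨h, hhA, hh, hmin⟩ := exists_nearest_contraction hτ hA hx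
  have hmin' : ∀ a ∈ subalg M A, IsSelfAdjoint a →
      (τ ((x - h) * (x - h))).re ≤ (τ ((x - a) * (x - a))).re := by
    intro a ha has
    obtain ⟨c, hc, hcs, hc1, hle⟩ := exists_contraction_closer hτ hx hx1 has ha
    exact (hmin c hc hcs hc1).trans hle
  have hsa : ∀ b ∈ subalg M A, IsSelfAdjoint b → τ (b * (x - h)) = 0 := by
    intro b hb hbs
    have him : (τ (b * (x - h))).im = 0 := by
      have := hτ.positive.map_star (b * (x - h))
      rw [star_mul, hbs.star_eq, (hx.sub hh).star_eq, hτ.tracial] at this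
      exact Complex.conj_eq_iff_im.1 this.symm
    have hre : ∀ t : ℝ, 2 * t * (τ (b * (x - h))).re ≤ t ^ 2 * (τ (b * b)).re := by
      intro t
      have hts : IsSelfAdjoint ((t : ℂ) • b) := by
        rw [IsSelfAdjoint, star_smul, hbs.star_eq]
        simp
      have h1 := hmin' (h + (t : ℂ) • b) (add_mem hhA ((subalg M A).smul_mem hb _)) (hh.add hts)
      rw [← sub_sub, trace_sq_sub hτ (x - h)] at h1
      simp only [smul_mul_assoc, mul_smul_comm, map_smul, smul_eq_mul, Complex.re_ofReal_mul] at h1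
      nlinarith
    refine Complex.ext ?_ (by simpa using him)
    rw [Complex.zero_re]
    set m := (τ (b * (x - h))).re
    have hN := trace_sq_nonneg hτ hbs
    set N := (τ (b * b)).re
    -- A near-optimal `t`; the `+ 1` covers `N = 0`.
    have := hre (m / (N + 1))
    have h2 : 2 * (m / (N + 1)) * m - (m / (N + 1)) ^ 2 * N
        = m ^ 2 * ((N + 2) / (N + 1) ^ 2) := by
      field_simp
      ring
    have h3 : m ^ 2 * ((N + 2) / (N + 1) ^ 2) ≤ 0 := by linarith
    have h4 : 0 < (N + 2) / (N + 1) ^ 2 := by positivity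
    have h5 : m ^ 2 ≤ 0 := by
      by_contra h6
      push Not at h6
      exact absurd h3 (not_le.2 (mul_pos h6 h4))
    exact pow_eq_zero_iff two_ne_zero |>.1 (le_antisymm h5 (sq_nonneg m))
  refine ⟨h, hhA, fun b hb => ?_⟩
  have h1 := hsa (b + star b) (add_mem hb (star_mem hb)) (IsSelfAdjoint.add_star_self b)
  have h2 := hsa (Complex.I • (b - star b)) ((subalg M A).smul_mem (sub_mem hb (star_mem hb)) _) (by
    rw [IsSelfAdjoint, star_smul, star_sub, star_star, Complex.star_def, Complex.conj_I, neg_smul,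
      ← smul_neg, neg_sub])
  rw [smul_mul_assoc, map_smul, smul_eq_mul, mul_eq_zero, or_iff_right Complex.I_ne_zero, sub_mul,
    map_sub] at h2
  rw [add_mul, map_add] at h1
  have h3 : τ (b * (x - h)) = 0 := by linear_combination (h1 + h2) / 2
  rw [mul_sub, map_sub, sub_eq_zero] at h3
  rw [hτ.tracial, ← h3, hτ.tracial]

theorem exists_projection (hτ : IsFaithfulNormalTrace τ) (hA : A ≤ M) (x : M.toStarSubalgebra) :
    ∃ h ∈ subalg M A, ∀ b ∈ subalg M A, τ (h * b) = τ (x * b) := by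
  have hsmul : ∀ (c : ℂ) (x : M.toStarSubalgebra),
      (∃ h ∈ subalg M A, ∀ b ∈ subalg M A, τ (h * b) = τ (x * b)) →
      ∃ h ∈ subalg M A, ∀ b ∈ subalg M A, τ (h * b) = τ ((c • x) * b) := by
    rintro c x ⟨h, hh, hb⟩
    exact ⟨c • h, (subalg M A).smul_mem hh c, fun b hbA => by
      rw [smul_mul_assoc, smul_mul_assoc, map_smul, map_smul, hb b hbA]⟩
  have hsa : ∀ x : M.toStarSubalgebra, IsSelfAdjoint x →
      ∃ h ∈ subalg M A, ∀ b ∈ subalg M A, τ (h * b) = τ (x * b) := by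
    intro x hx
    set c : ℝ := ‖(x : H →L[ℂ] H)‖ + 1
    have hc : 0 < c := by positivity
    have hcx : x = (c : ℂ) • ((c⁻¹ : ℝ) : ℂ) • x := by
      rw [smul_smul, ← Complex.ofReal_mul, mul_inv_cancel₀ hc.ne', Complex.ofReal_one, one_smul]
    rw [hcx]
    refine hsmul _ _ (exists_projection_of_contraction hτ hA ?_ ?_)
    · rw [IsSelfAdjoint, star_smul, hx.star_eq]
      simp
    · change ‖((c⁻¹ : ℝ) : ℂ) • (x : H →L[ℂ] H)‖ ≤ 1
      rw [norm_smul, Complex.norm_real, Real.norm_of_nonneg (by positivity), inv_mul_le_iff₀ hc]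
      simp [c]
  -- `x = (1/2)(x + x⋆) + (-i/2)(i (x - x⋆))`, with both brackets self-adjoint.
  obtain ⟨h1, hh1, hb1⟩ := hsmul (1 / 2) _ (hsa (x + star x) (IsSelfAdjoint.add_star_self x))
  obtain ⟨h2, hh2, hb2⟩ := hsmul (-Complex.I / 2) _ (hsa (Complex.I • (x - star x)) (by
    rw [IsSelfAdjoint, star_smul, star_sub, star_star, Complex.star_def, Complex.conj_I, neg_smul,
      ← smul_neg, neg_sub]))
  refine ⟨h1 + h2, add_mem hh1 hh2, fun b hb => ?_⟩
  rw [add_mul, map_add, hb1 b hb, hb2 b hb]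
  simp only [smul_mul_assoc, map_smul, smul_eq_mul, add_mul, sub_mul, map_add, map_sub]
  linear_combination (-1 / 2 * (τ (x * b) - τ (star x * b))) * Complex.I_mul_I

theorem projection_unique (hτ : IsFaithfulNormalTrace τ) {h k : M.toStarSubalgebra}
    (hh : h ∈ subalg M A) (hk : k ∈ subalg M A)
    (heq : ∀ b ∈ subalg M A, τ (h * b) = τ (k * b)) : h = k := by
  rw [← sub_eq_zero]
  apply hτ.faithful
  rw [hτ.tracial, sub_mul, map_sub, heq _ (star_mem (sub_mem hh hk)), sub_self]

/-- Linearity and the bimodule property follow from uniqueness of the projection. Positivity comes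
from testing against the negative part. -/
theorem exists_isCondExp (hτ : IsFaithfulNormalTrace τ) (hA : A ≤ M) :
    ∃ E : SelfMap M, IsCondExp τ A E := by
  choose e heA he using exists_projection hτ hA
  let E : SelfMap M :=
    { toFun := e
      map_add' := fun x y => projection_unique hτ (heA _) (add_mem (heA _) (heA _)) fun b hb => by
        rw [he _ b hb, add_mul, add_mul, map_add, map_add, he x b hb, he y b hb]
      map_smul' := fun c x => projection_unique hτ (heA _)
        ((subalg M A).smul_mem (heA _) c) fun b hb => by
        rw [he _ b hb, RingHom.id_apply, smul_mul_assoc, smul_mul_assoc, map_smul, map_smul,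
          he x b hb] }
  have hE : ∀ x, E x = e x := fun _ => rfl
  refine ⟨E, heA, ?_, ?_, ?_, ?_⟩
  · intro a ha
    exact projection_unique hτ (heA _) ha (he a)
  · intro x
    have hs : IsSelfAdjoint (e (star x * x)) := by
      refine projection_unique hτ (star_mem (heA _)) (heA _) fun b hb => ?_
      rw [hτ.tracial, ← star_star b, ← star_mul, hτ.positive.map_star, he _ _ (star_mem hb),
        ← hτ.positive.map_star, star_mul, he _ _ (star_mem (star_mem hb)), hτ.tracial]
      simp
    set h := e (star x * x)
    let p : ℝ → ℝ := fun t => max (-t) 0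
    let q : ℝ → ℝ := fun t => max t 0
    have hp : Continuous p := by fun_prop
    have hq : Continuous q := by fun_prop
    have hqp : fc q h - fc p h = h := by
      conv_rhs => rw [← fc_id hs]
      rw [fc_sub hq hp]
      congr 1
      ext t
      simp only [p, q]
      rcases le_total t 0 with h | h <;> simp [h]
    have hhp : h * fc p h = -(fc p h * fc p h) := by
      conv_lhs => rw [← fc_id hs]
      rw [fc_id hs]
      conv_lhs => enter [1]; rw [← fc_id hs]
      rw [fc_mul continuous_id' hp, fc_mul hp hp, fc_neg]
      congr 1
      ext t
      simp only [p]
      rcases le_total t 0 with h | h <;> simp [h]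
    -- Let `p` be the negative part of `h`. Then `τ(h p) = τ(x⋆x p) ≥ 0`, while `h p = -p²`;
    -- faithfulness gives `p = 0`.
    have hp0 : fc p h = 0 := by
      apply hτ.faithful
      rw [(isSelfAdjoint_fc p h).star_eq]
      have h1 := tracial_mul_nonneg hτ.positive hτ.tracial x (fc (fun t => √(p t)) h)
      rw [← fc_eq_star_mul_self hp (fun t => le_max_right _ _),
        ← he _ _ (fc_mem (heA _) p), hhp, map_neg] at h1
      have h2 := hτ.positive (fc p h)
      rw [(isSelfAdjoint_fc p h).star_eq] at h2
      exact le_antisymm (neg_nonneg.1 h1) h2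
    refine ⟨fc (fun t => √(q t)) h, ?_⟩
    rw [← fc_eq_star_mul_self hq (fun t => le_max_right _ _), hE]
    rw [hp0, sub_zero] at hqp
    exact hqp.symm
  · intro a b x ha hb
    refine projection_unique hτ (heA _) (mul_mem (mul_mem (show a ∈ subalg M A from ha) (heA _)) hb)
      fun c hc => ?_
    rw [hE, he _ c hc]
    have h1 : a * x * b * c = a * (x * (b * c)) := by simp only [mul_assoc]
    have h2 : a * e x * b * c = a * (e x * (b * c)) := by simp only [mul_assoc]
    rw [hE, h1, h2, hτ.tracial, hτ.tracial a, mul_assoc x, mul_assoc (e x),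
      he _ _ (mul_mem (mul_mem hb hc) ha)]
  · intro x
    simpa [hE] using he x 1 (one_mem _)

theorem isCondExp_condExp (hτ : IsFaithfulNormalTrace τ) (hA : A ≤ M) :
    IsCondExp τ A (condExp τ A) := by
  have h := exists_isCondExp hτ hA
  rw [condExp, dif_pos h]
  exact h.choose_spec

end CondExp

end VNEntropy

/-! ### Conditional expectations and relative entropy -/

namespace VNEntropy

variable {H : Type*} [NormedAddCommGroup H] [InnerProductSpace ℂ H] [CompleteSpace H]
  {M A B : VonNeumannAlgebra H} {τ φ ψ : Functional M} {E : SelfMap M}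

theorem IsCondExp.map_one (hE : IsCondExp τ A E) : E 1 = 1 :=
  hE.map_of_mem 1 A.toStarSubalgebra.one_mem

theorem IsCondExp.map_mul_left (hE : IsCondExp τ A E) {a : M.toStarSubalgebra}
    (ha : (a : H →L[ℂ] H) ∈ A) (x : M.toStarSubalgebra) : E (a * x) = a * E x := by
  simpa using hE.bimodule a 1 x ha A.toStarSubalgebra.one_mem

theorem IsCondExp.map_mul_right (hE : IsCondExp τ A E) {a : M.toStarSubalgebra}
    (ha : (a : H →L[ℂ] H) ∈ A) (x : M.toStarSubalgebra) : E (x * a) = E x * a := by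
  simpa using hE.bimodule 1 a x A.toStarSubalgebra.one_mem ha

theorem IsCondExp.map_star (hτ : IsFaithfulNormalTrace τ) (hE : IsCondExp τ A E)
    (x : M.toStarSubalgebra) : E (star x) = star (E x) := by
  refine projection_unique (A := A) hτ (hE.mem _) (A.toStarSubalgebra.star_mem' (hE.mem x))
    fun b hb => ?_
  have hbs : ((star b : M.toStarSubalgebra) : H →L[ℂ] H) ∈ A := A.toStarSubalgebra.star_mem' hb
  rw [← hE.map_mul_right hb, hE.trace_preserving, ← star_star b, ← star_mul, ← star_mul,
    hτ.positive.map_star, hτ.positive.map_star, ← hE.map_mul_left hbs, hE.trace_preserving]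

theorem IsCondExp.positive_comp (hE : IsCondExp τ A E) (hψ : IsPositive ψ) :
    IsPositive (ψ ∘ₗ E) := by
  intro x
  obtain ⟨y, hy⟩ := hE.positive x
  rw [LinearMap.comp_apply, hy]
  exact hψ y

/-- The Schwarz inequality for a conditional expectation. -/
theorem IsCondExp.schwarz (hτ : IsFaithfulNormalTrace τ) (hE : IsCondExp τ A E)
    (hψ : IsPositive ψ) (y : M.toStarSubalgebra) :
    (ψ (star (E y) * E y)).re ≤ (ψ (E (star y * y))).re := by
  -- Expand `E((y - E y)⋆ (y - E y)) = E(y⋆y) - (E y)⋆ (E y)`.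
  have h := (Complex.nonneg_iff.1 (hE.positive_comp hψ (y - E y))).1
  have hs : ((star (E y) : M.toStarSubalgebra) : H →L[ℂ] H) ∈ A :=
    A.toStarSubalgebra.star_mem' (hE.mem y)
  have heq : E (star (y - E y) * (y - E y)) = E (star y * y) - star (E y) * E y := by
    rw [star_sub, sub_mul, mul_sub, mul_sub, map_sub, map_sub, map_sub,
      hE.map_mul_right (hE.mem y), hE.map_mul_left hs, hE.map_mul_left hs,
      hE.map_of_mem (E y) (hE.mem y), hE.map_star hτ]
    abel
  rw [LinearMap.comp_apply, heq, map_sub, Complex.sub_re] at h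
  linarith

/-- Monotonicity of the relative entropy under restriction to a subalgebra. -/
theorem relEntropy_restrict_mono (hB : B ≤ M) (hA : A ≤ M) (hBA : B ≤ A) :
    relEntropy (restrict hB ψ) (restrict hB φ) ≤ relEntropy (restrict hA ψ) (restrict hA φ) :=
  relEntropy_le_of_map (StarSubalgebra.inclusion (S₁ := B.toStarSubalgebra)
    (S₂ := A.toStarSubalgebra) hBA) rfl (fun _ => le_rfl) (fun _ => le_rfl)

theorem restrict_comp_of_le (hE : IsCondExp τ A E) (hB : B ≤ M) (hBA : B ≤ A) :
    restrict hB (ψ ∘ₗ E) = restrict hB ψ := by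
  ext b
  exact congrArg ψ (hE.map_of_mem _ (hBA b.2))

/-- If a conditional expectation onto `A` maps `B` into `N`, where `N ⊆ A ∩ B`, then the relative
entropy of invariant functionals on `B` is attained on `N`. -/
theorem relEntropy_restrict_comp (hτ : IsFaithfulNormalTrace τ) (hE : IsCondExp τ A E)
    (hψ : IsPositive ψ) (hφ : IsPositive φ) {N : VonNeumannAlgebra H} (hB : B ≤ M) (hN : N ≤ M)
    (hNA : N ≤ A) (hNB : N ≤ B) (hEB : ∀ b : M.toStarSubalgebra, (b : H →L[ℂ] H) ∈ B →
      (E b : H →L[ℂ] H) ∈ N) :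
    relEntropy (restrict hB (ψ ∘ₗ E)) (restrict hB (φ ∘ₗ E))
      = relEntropy (restrict hN ψ) (restrict hN φ) := by
  apply le_antisymm
  · let i : B.toStarSubalgebra → M.toStarSubalgebra := fun b => ⟨b, hB b.2⟩
    refine relEntropy_le_of_map (fun b => ⟨E (i b), hEB (i b) b.2⟩) ?_ (fun x => ?_) (fun x => ?_)
    · exact congrArg ψ hE.map_one
    · have h := hE.schwarz hτ hψ (1 - i x)
      rw [map_sub, hE.map_one] at h
      exact h
    -- The second form is in `x x⋆`, so Schwarz is applied to `x⋆`.
    · have h := hE.schwarz hτ hφ (star (i x))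
      rw [hE.map_star hτ, star_star, star_star] at h
      exact h
  · rw [← restrict_comp_of_le (ψ := ψ) hE hN hNA, ← restrict_comp_of_le (ψ := φ) hE hN hNA]
    exact relEntropy_restrict_mono hN hB hNB

theorem IsPositive.map_one_eq_re (hψ : IsPositive ψ) : ψ 1 = ((ψ 1).re : ℂ) ∧ 0 ≤ (ψ 1).re := by
  have h := Complex.nonneg_iff.1 (hψ 1)
  rw [star_one, one_mul] at h
  exact ⟨Complex.ext rfl (by simpa using h.2.symm), h.1⟩

/-! ### Comparison of the entropy suprema -/

theorem sub_relEntropy_scalars (hψ : IsPositive ψ) (hφ : φ 1 = 1) (a : EReal) :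
    a - relEntropy (restrict (scalars_le M) ψ) (restrict (scalars_le M) φ)
      = (Real.negMulLog (ψ 1).re : EReal) + a := by
  rw [relEntropy_scalars (p := (ψ 1).re) hψ.map_one_eq_re.2 hψ.map_one_eq_re.1 hφ,
    EReal.coe_neg, sub_eq_add_neg, neg_neg, add_comm]

theorem relH_scalars (hφ : φ 1 = 1) (hA : A ≤ M) : relH φ hA (scalars_le M) = entH φ hA := by
  refine iSup_congr fun k => iSup_congr fun f => iSup_congr fun hf =>
    Finset.sum_congr rfl fun i _ => sub_relEntropy_scalars (hf.1 i) hφ _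

theorem decomp_comp (hE : IsCondExp τ A E) {k : ℕ} {f : Fin k → Functional M}
    (hf : f ∈ decomp φ k) : (fun i => f i ∘ₗ E) ∈ decomp (φ ∘ₗ E) k := by
  refine ⟨fun i => hE.positive_comp (hf.1 i), ?_⟩
  rw [hf.2]
  ext x
  simp

theorem relH_eq_relh_of_le (hτ : IsFaithfulNormalTrace τ) (hA : A ≤ M) (hB : B ≤ M)
    (hBA : B ≤ A) : relH φ hA hB = relh τ φ hA hB := by
  have hE := isCondExp_condExp hτ hA
  simp only [relH, relh, restrict_comp_of_le hE hB hBA]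

/-- Composing with `E_A` changes neither the value at `1` nor the restriction to `A`. -/
theorem entH_eq_enth (hτ : IsFaithfulNormalTrace τ) (hA : A ≤ M) :
    entH φ hA = enth τ φ hA := by
  have hE := isCondExp_condExp hτ hA
  refine iSup_congr fun k => ?_
  have hterm : ∀ f : Fin k → Functional M,
      ∑ i, ((Real.negMulLog ((f i ∘ₗ condExp τ A) 1).re : EReal)
        + relEntropy (restrict hA (f i ∘ₗ condExp τ A)) (restrict hA φ))
      = ∑ i, ((Real.negMulLog (f i 1).re : EReal)
        + relEntropy (restrict hA (f i)) (restrict hA φ)) := fun f =>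
    Finset.sum_congr rfl fun i _ => by
      rw [restrict_comp_of_le hE hA le_rfl, LinearMap.comp_apply, hE.map_one]
  apply le_antisymm
  · refine iSup₂_le fun f hf => ?_
    refine le_iSup₂_of_le (fun i => f i ∘ₗ condExp τ A) ⟨f, hf, fun _ => rfl⟩ ?_
    exact (hterm f).ge
  · refine iSup₂_le fun g hg => ?_
    obtain ⟨f, hf, hgf⟩ := hg
    obtain rfl : g = fun i => f i ∘ₗ condExp τ A := funext hgf
    exact le_iSup₂_of_le f hf (hterm f).le

/-- For `b ∈ B`, commutation gives `E_A b = E_A E_B b = E_B E_A b`. -/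
theorem condExp_mem_inter (hτ : IsFaithfulNormalTrace τ) (hA : A ≤ M) (hB : B ≤ M)
    (hAB : condExp τ A ∘ₗ condExp τ B = condExp τ B ∘ₗ condExp τ A) (b : M.toStarSubalgebra)
    (hb : (b : H →L[ℂ] H) ∈ B) : (condExp τ A b : H →L[ℂ] H) ∈ inter A B := by
  refine ⟨(isCondExp_condExp hτ hA).mem b, ?_⟩
  have h := LinearMap.congr_fun hAB b
  rw [LinearMap.comp_apply, (isCondExp_condExp hτ hB).map_of_mem b hb] at h
  rw [h]
  exact (isCondExp_condExp hτ hB).mem _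

theorem inter_le_right (A B : VonNeumannAlgebra H) : inter A B ≤ B := fun _ h => h.2

theorem relEntropy_restrict_comp_inter (hτ : IsFaithfulNormalTrace τ) (hψ : IsPositive ψ)
    (hφ : IsPositive φ) (hA : A ≤ M) (hB : B ≤ M)
    (hAB : condExp τ A ∘ₗ condExp τ B = condExp τ B ∘ₗ condExp τ A) :
    relEntropy (restrict hB (ψ ∘ₗ condExp τ A)) (restrict hB (φ ∘ₗ condExp τ A))
      = relEntropy (restrict ((inter_le_left A B).trans hA) ψ)
        (restrict ((inter_le_left A B).trans hA) φ) :=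
  relEntropy_restrict_comp hτ (isCondExp_condExp hτ hA) hψ hφ hB _ (inter_le_left A B)
    (inter_le_right A B) (condExp_mem_inter hτ hA hB hAB)

theorem relh_eq_relh_inter (hτ : IsFaithfulNormalTrace τ) (hφ : IsPositive φ) (hA : A ≤ M)
    (hB : B ≤ M) (hAB : condExp τ A ∘ₗ condExp τ B = condExp τ B ∘ₗ condExp τ A) :
    relh τ φ hA hB = relh τ φ hA ((inter_le_left A B).trans hA) := by
  have hE := isCondExp_condExp hτ hA
  refine iSup_congr fun k => iSup_congr fun f => iSup_congr fun hf =>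
    Finset.sum_congr rfl fun i _ => ?_
  rw [relEntropy_restrict_comp_inter hτ (hf.1 i) hφ hA hB hAB,
    restrict_comp_of_le hE _ (inter_le_left A B), restrict_comp_of_le hE _ (inter_le_left A B)]

/-- Monotonicity gives one inequality. For the other, `(φᵢ ∘ E_A)` is again a decomposition of `φ =
φ ∘ E_A`; it agrees with `(φᵢ)` on `A`, and its entropies on `B` are those of `(φᵢ)` on `A ∩ B`. -/
theorem relH_eq_relH_inter (hτ : IsFaithfulNormalTrace τ) (hφ : IsPositive φ) (hA : A ≤ M)
    (hB : B ≤ M) (hAB : condExp τ A ∘ₗ condExp τ B = condExp τ B ∘ₗ condExp τ A)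
    (hφA : φ = φ ∘ₗ condExp τ A) :
    relH φ hA hB = relH φ hA ((inter_le_left A B).trans hA) := by
  have hE := isCondExp_condExp hτ hA
  apply le_antisymm
  · exact iSup_mono fun _ => iSup_mono fun _ => iSup_mono fun _ => Finset.sum_le_sum fun _ _ =>
      EReal.sub_le_sub le_rfl (relEntropy_restrict_mono _ _ (inter_le_right A B))
  · refine iSup_le fun k => iSup₂_le fun f hf => ?_
    have hf' := decomp_comp hE hf
    rw [← hφA] at hf'
    refine le_iSup_of_le k (le_iSup₂_of_le _ hf' (Finset.sum_le_sum fun i _ => ?_))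
    have h := relEntropy_restrict_comp_inter hτ (hf.1 i) hφ hA hB hAB
    rw [← hφA] at h
    rw [h, restrict_comp_of_le hE hA le_rfl]

theorem relh_le_relh_scalars (hA : A ≤ M) (hB : B ≤ M) :
    relh τ φ hA hB ≤ relh τ φ hA (scalars_le M) :=
  iSup_mono fun _ => iSup_mono fun _ => iSup_mono fun _ => Finset.sum_le_sum fun _ _ =>
    EReal.sub_le_sub le_rfl (relEntropy_restrict_mono _ _ (scalars_le B))

theorem relh_scalars (hτ : IsFaithfulNormalTrace τ) (hφ : φ 1 = 1) (hA : A ≤ M) :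
    relh τ φ hA (scalars_le M) = enth τ φ hA := by
  rw [← relH_eq_relh_of_le hτ hA (scalars_le M) (scalars_le A), relH_scalars hφ hA,
    entH_eq_enth hτ hA]

theorem relh_congr {N N' : VonNeumannAlgebra H} (h : N = N') (hA : A ≤ M) (hN : N ≤ M)
    (hN' : N' ≤ M) : relh τ φ hA hN = relh τ φ hA hN' := by
  subst h
  rfl

theorem relH_congr {N N' : VonNeumannAlgebra H} (h : N = N') (hA : A ≤ M) (hN : N ≤ M)
    (hN' : N' ≤ M) : relH φ hA hN = relH φ hA hN' := by
  subst h
  rfl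

end VNEntropy

theorem theorem2p2p2 {H : Type*} [NormedAddCommGroup H] [InnerProductSpace ℂ H] [CompleteSpace H]
    (M : VonNeumannAlgebra H) (τ : VNEntropy.Functional M)
    (hτ : VNEntropy.IsFaithfulNormalTrace τ)
    (φ : VNEntropy.Functional M) (hφ : VNEntropy.IsNormalState φ)
    (A B : VonNeumannAlgebra H) (hA : A ≤ M) (hB : B ≤ M) :
    -- (1)
    (VNEntropy.relh τ φ hA hB ≤ VNEntropy.relh τ φ hA (VNEntropy.scalars_le M) ∧
      VNEntropy.relh τ φ hA (VNEntropy.scalars_le M) = VNEntropy.enth τ φ hA) ∧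
    -- (2)
    (VNEntropy.condExp τ A ∘ₗ VNEntropy.condExp τ B
        = VNEntropy.condExp τ B ∘ₗ VNEntropy.condExp τ A →
      VNEntropy.relh τ φ hA hB
          = VNEntropy.relh τ φ hA ((VNEntropy.inter_le_left A B).trans hA) ∧
      (VNEntropy.inter A B = VNEntropy.scalars H →
        VNEntropy.relh τ φ hA hB = VNEntropy.enth τ φ hA)) ∧
    -- (3)
    (VNEntropy.condExp τ A ∘ₗ VNEntropy.condExp τ B
        = VNEntropy.condExp τ B ∘ₗ VNEntropy.condExp τ A →
      φ = φ ∘ₗ VNEntropy.condExp τ A →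
      VNEntropy.relH φ hA hB
          = VNEntropy.relH φ hA ((VNEntropy.inter_le_left A B).trans hA) ∧
      (VNEntropy.inter A B = VNEntropy.scalars H →
        VNEntropy.relH φ hA hB = VNEntropy.entH φ hA)) ∧
    -- (4)
    ((B ≤ A → VNEntropy.relH φ hA hB = VNEntropy.relh τ φ hA hB) ∧
      VNEntropy.entH φ hA = VNEntropy.enth τ φ hA) := by
  have hφ1 := hφ.map_one
  refine ⟨⟨VNEntropy.relh_le_relh_scalars hA hB, VNEntropy.relh_scalars hτ hφ1 hA⟩,
    fun hAB => ?_, fun hAB hφA => ?_, VNEntropy.relH_eq_relh_of_le hτ hA hB,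
    VNEntropy.entH_eq_enth hτ hA⟩
  · have h := VNEntropy.relh_eq_relh_inter hτ hφ.positive hA hB hAB
    refine ⟨h, fun hI => ?_⟩
    rw [h, VNEntropy.relh_congr hI hA _ (VNEntropy.scalars_le M), VNEntropy.relh_scalars hτ hφ1 hA]
  · have h := VNEntropy.relH_eq_relH_inter hτ hφ.positive hA hB hAB hφA
    refine ⟨h, fun hI => ?_⟩
    rw [h, VNEntropy.relH_congr hI hA _ (VNEntropy.scalars_le M), VNEntropy.relH_scalars hφ1 hA]
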